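/- Let $n\ge 3$ and let $s\in\mathbb{Z}_n\setminus\{0\}$. The generalized Petersen graph $\mathrm{GP}(n,s)$ is the simple graph with vertex set $\{u_i, v_i : i\in\mathbb{Z}_n\}$ and edges $u_iu_{i+1}$, $u_iv_i$ and $v_iv_{i+s}$ for $i\in\mathbb{Z}_n$; thus $\mathrm{GP}(n,s)=\mathrm{GP}(n,-s)$. A graph is edge-transitive (respectively arc-transitive) if its automorphism group acts transitively on its edges (respectively on its ordered pairs of adjacent vertices). Then $\mathrm{GP}(n,s)$ is edge-transitive if and only if, after possibly replacing $s$ by $-s$, the pair $(n,s)$ is one of $$(4,1),\ (5,2),\ (8,3),\ (10,2),\ (10,3),\ (12,5),\ (24,5).$$ Moreover, if $\mathrm{GP}(n,s)$ is edge-transitive, then it is arc-transitive. -/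

import Mathlib

/-- The generalized Petersen graph `GP(n,s)`: the bicirculant over `ZMod n` with symbol
`[[{1,-1}, {0}], [{0}, {s,-s}]]`. The two orbits of `ZMod n` are `Sum.inl` (outer rim) and
`Sum.inr` (inner rim); an entry `S i j` of the symbol lists the differences along the arcs from
orbit `i` to orbit `j`. (For `n ≥ 2` and `s ≠ 0` the conditions `i ≠ j` are automatic.) -/
def genPetersen (n : ℕ) (s : ZMod n) : SimpleGraph (ZMod n ⊕ ZMod n) where
  Adj
    | Sum.inl i, Sum.inl j => i ≠ j ∧ (j - i = 1 ∨ j - i = -1)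
    | Sum.inl i, Sum.inr j => j - i = 0
    | Sum.inr i, Sum.inl j => j - i = 0
    | Sum.inr i, Sum.inr j => i ≠ j ∧ (j - i = s ∨ j - i = -s)
  symm := ⟨by
    rintro (i | i) (j | j) h
    · exact ⟨h.1.symm, h.2.symm.imp (fun e => by rw [← neg_sub, e, neg_neg])
        (fun e => by rw [← neg_sub, e])⟩
    · exact (sub_eq_zero.2 (sub_eq_zero.1 h).symm :)
    · exact (sub_eq_zero.2 (sub_eq_zero.1 h).symm :)
    · exact ⟨h.1.symm, h.2.symm.imp (fun e => by rw [← neg_sub, e, neg_neg])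
        (fun e => by rw [← neg_sub, e])⟩⟩
  loopless := ⟨by
    rintro (i | i) h
    · exact h.1 rfl
    · exact h.1 rfl⟩

/-- The automorphism group of `G` acts transitively on the edges of `G`. -/
def SimpleGraph.IsEdgeTransitive {V : Type*} (G : SimpleGraph V) : Prop :=
  ∀ e ∈ G.edgeSet, ∀ f ∈ G.edgeSet, ∃ φ : G ≃g G, Sym2.map φ e = f

/-- The automorphism group of `G` acts transitively on the arcs (ordered pairs of adjacent
vertices) of `G`. -/
def SimpleGraph.IsArcTransitive {V : Type*} (G : SimpleGraph V) : Prop :=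
  ∀ u v x y : V, G.Adj u v → G.Adj x y → ∃ φ : G ≃g G, φ u = x ∧ φ v = y

/-- The list of exceptional parameter pairs `(n, s)`. -/
def gpPairs : Finset (ℕ × ℕ) :=
  {(4, 1), (5, 2), (8, 3), (10, 2), (10, 3), (12, 5), (24, 5)}

/-
Edge-transitivity implies arc-transitivity because a reflection of the graph reverses an outer edge.
If `2 * s = 0`, outer vertices have degree 3 and inner ones at most 2, so `GP(n, s)` is not
arc-transitive.

In an arc-transitive graph the number of closed walks of length `k` through an arc that nowhere
backtrack, not even where they close up, does not depend on the arc. The graphs `GP(n, s)` with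
`2 * s ≠ 0` have a common cover with outer and inner vertices indexed by `ℤ × ℤ`. There a closed
walk becomes a walk between two points whose displacement `(a, b)` satisfies `a + b * s = 0` in
`ZMod n`, and the displacements can be listed once and for all. Comparing outer edges, inner edges
and spokes gives, for each `k`, two linear equations between the indicators of the relations
`a + b * s = 0`. For `k = 4, 5, 6, 8` these leave only the pairs of the list and `n = 13, 26` with
`s = ±5`, which `k = 10` excludes.

Conversely, for each pair of the list there is an involution that exchanges some outer and some
inner edges with spokes, so that together with the rotations it makes all edges equivalent.
-/

section Graph

variable {V : Type*} {G : SimpleGraph V}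

theorem isArcTransitive_of_isEdgeTransitive_of_swap (h : G.IsEdgeTransitive) {u v : V}
    (huv : G.Adj u v) {ρ : G ≃g G} (hu : ρ u = v) (hv : ρ v = u) : G.IsArcTransitive := by
  have fromArc (x y : V) (hxy : G.Adj x y) : ∃ φ : G ≃g G, φ u = x ∧ φ v = y := by
    obtain ⟨φ, hφ⟩ := h s(u, v) huv s(x, y) hxy
    rw [Sym2.map_mk, Sym2.eq_iff] at hφ
    obtain hφ | ⟨hux, hvy⟩ := hφ
    · exact ⟨φ, hφ⟩
    · exact ⟨ρ.trans φ, by simp [hu, hvy], by simp [hv, hux]⟩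
  intro x y z w hxy hzw
  obtain ⟨φ, rfl, rfl⟩ := fromArc x y hxy
  obtain ⟨ψ, rfl, rfl⟩ := fromArc z w hzw
  exact ⟨φ.symm.trans ψ, by simp, by simp⟩

theorem isEdgeTransitive_of_forall_exists_map {e : Sym2 V}
    (h : ∀ f ∈ G.edgeSet, ∃ φ : G ≃g G, Sym2.map φ f = e) : G.IsEdgeTransitive := by
  intro f hf g hg
  obtain ⟨φ, hφ⟩ := h f hf
  obtain ⟨ψ, hψ⟩ := h g hg
  refine ⟨φ.trans ψ.symm, ?_⟩
  have hψ' : Sym2.map ψ.symm e = g := by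
    rw [← hψ, Sym2.map_map, show ⇑ψ.symm ∘ ⇑ψ = id from funext ψ.symm_apply_apply, Sym2.map_id,
      id]
  rw [← hψ', ← hφ, Sym2.map_map]
  rfl

variable [G.LocallyFinite]

theorem degree_eq_of_isArcTransitive (h : G.IsArcTransitive) {x y : V} (hxy : G.Adj x y) :
    G.degree x = G.degree y := by
  obtain ⟨φ, rfl, -⟩ := h x y y x hxy hxy.symm
  exact (φ.degree_eq x).symm

variable [DecidableEq V]

/-- The number of non-backtracking walks with `k + 1` steps whose first step is the arc `(x, y)` and
whose last step is the arc `(u, v)`. For `(x, y) = (u, v)` these are the closed walks of length `k`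
through `(x, y)` that do not backtrack where they close up either. -/
def nbWalkCount (G : SimpleGraph V) [G.LocallyFinite] : ℕ → V → V → V → V → ℕ
  | 0, x, y, u, v => if x = u ∧ y = v then 1 else 0
  | k + 1, x, y, u, v => ∑ z ∈ (G.neighborFinset y).erase x, nbWalkCount G k y z u v

theorem nbWalkCount_map_iso (φ : G ≃g G) (k : ℕ) (x y u v : V) :
    nbWalkCount G k (φ x) (φ y) (φ u) (φ v) = nbWalkCount G k x y u v := by
  induction k generalizing x y with
  | zero => simp [nbWalkCount]
  | succ k ih =>
    symm
    refine Finset.sum_equiv φ.toEquiv (fun z => ?_) fun z _ => (ih y z).symm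
    simp [φ.map_adj_iff]

theorem nbWalkCount_eq_of_isArcTransitive (h : G.IsArcTransitive) (k : ℕ) {x y u v : V}
    (hxy : G.Adj x y) (huv : G.Adj u v) :
    nbWalkCount G k x y x y = nbWalkCount G k u v u v := by
  obtain ⟨φ, rfl, rfl⟩ := h x y u v hxy huv
  exact (nbWalkCount_map_iso φ k x y x y).symm

end Graph

section GraphCover

variable {V W : Type*} {G : SimpleGraph V}

/-- The map `f` is a covering of `G` by the graph on `W` in which `nbrs w` lists the neighbors of
`w`. Neighbors are kept in lists so that walks upstairs can be enumerated by evaluation. -/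
structure IsGraphCover (G : SimpleGraph V) (nbrs : W → List W) (f : W → V) : Prop where
  mem_symm {w z : W} : z ∈ nbrs w → w ∈ nbrs z
  nodup_map (w : W) : ((nbrs w).map f).Nodup
  mem_map_iff (w : W) (v : V) : v ∈ (nbrs w).map f ↔ G.Adj (f w) v

/-- The last steps of the non-backtracking walks with `k + 1` steps and first step `(x, y)`. -/
def nbWalkEnds [DecidableEq W] (nbrs : W → List W) : ℕ → W → W → List (W × W)
  | 0, x, y => [(x, y)]
  | k + 1, x, y => ((nbrs y).filter (· ≠ x)).flatMap (nbWalkEnds nbrs k y)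

variable {nbrs : W → List W} {f : W → V}

theorem IsGraphCover.adj (hf : IsGraphCover G nbrs f) {x y : W} (hxy : y ∈ nbrs x) :
    G.Adj (f x) (f y) :=
  (hf.mem_map_iff x _).1 (List.mem_map_of_mem hxy)

theorem IsGraphCover.injOn (hf : IsGraphCover G nbrs f) (w : W) : Set.InjOn f {z | z ∈ nbrs w} :=
  fun _ hx _ hy => List.inj_on_of_nodup_map (hf.nodup_map w) hx hy

theorem IsGraphCover.neighborFinset_eq [DecidableEq V] [G.LocallyFinite]
    (hf : IsGraphCover G nbrs f) (w : W) :
    G.neighborFinset (f w) = ((nbrs w).map f).toFinset := by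
  ext v
  rw [SimpleGraph.mem_neighborFinset, List.mem_toFinset, hf.mem_map_iff]

variable [DecidableEq W]

theorem mem_of_mem_nbWalkEnds {k : ℕ} {x y : W} (hxy : y ∈ nbrs x) {e : W × W}
    (he : e ∈ nbWalkEnds nbrs k x y) : e.2 ∈ nbrs e.1 := by
  induction k generalizing x y with
  | zero =>
    rw [List.mem_singleton.1 he]
    exact hxy
  | succ k ih =>
    obtain ⟨z, hz, he⟩ := List.mem_flatMap.1 he
    exact ih (List.mem_of_mem_filter hz) he

theorem IsGraphCover.nbWalkCount_eq [DecidableEq V] [G.LocallyFinite]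
    (hf : IsGraphCover G nbrs f) (k : ℕ) {x y : W} (hxy : y ∈ nbrs x) (u v : V) :
    nbWalkCount G k (f x) (f y) u v =
      (nbWalkEnds nbrs k x y).countP fun e => f e.1 = u ∧ f e.2 = v := by
  induction k generalizing x y with
  | zero => simp [nbWalkCount, nbWalkEnds, List.countP_singleton]
  | succ k ih =>
    have hsub : (nbrs y).filter (· ≠ x) ⊆ nbrs y := List.filter_subset_self _
    have lift : (G.neighborFinset (f y)).erase (f x) =
        (((nbrs y).filter (· ≠ x)).map f).toFinset := by
      ext v
      simp only [hf.neighborFinset_eq, Finset.mem_erase, List.mem_toFinset, List.mem_map,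
        List.mem_filter, decide_eq_true_eq]
      constructor
      · rintro ⟨hvx, z, hz, rfl⟩
        exact ⟨z, ⟨hz, fun hzx => hvx (congrArg f hzx)⟩, rfl⟩
      · rintro ⟨z, ⟨hz, hzx⟩, rfl⟩
        exact ⟨fun h => hzx (hf.injOn y hz (hf.mem_symm hxy) h), z, hz, rfl⟩
    have nodup : (((nbrs y).filter (· ≠ x)).map f).Nodup :=
      (hf.nodup_map y).sublist (List.filter_sublist.map f)
    rw [nbWalkCount, lift, List.sum_toFinset _ nodup, List.map_map, nbWalkEnds,
      List.countP_flatMap]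
    exact congrArg List.sum (List.map_congr_left fun z hz => ih (hsub hz))

end GraphCover

namespace genPetersen

section Automorphisms

variable {n : ℕ} {s i j : ZMod n}

theorem neg_right : genPetersen n (-s) = genPetersen n s := by
  ext x y
  rcases x with i | i <;> rcases y with j | j <;> simp [genPetersen, or_comm]

theorem adj_inl_inl : (genPetersen n s).Adj (.inl i) (.inl j) ↔
    i ≠ j ∧ (j - i = 1 ∨ j - i = -1) := Iff.rfl

theorem adj_inr_inr : (genPetersen n s).Adj (.inr i) (.inr j) ↔
    i ≠ j ∧ (j - i = s ∨ j - i = -s) := Iff.rfl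

theorem adj_inl_inr : (genPetersen n s).Adj (.inl i) (.inr j) ↔ i = j :=
  sub_eq_zero.trans eq_comm

theorem adj_inr_inl : (genPetersen n s).Adj (.inr i) (.inl j) ↔ i = j :=
  sub_eq_zero.trans eq_comm

instance decidableAdj (n : ℕ) (s : ZMod n) : DecidableRel (genPetersen n s).Adj
  | .inl i, .inl j => inferInstanceAs (Decidable (i ≠ j ∧ (j - i = 1 ∨ j - i = -1)))
  | .inl i, .inr j => inferInstanceAs (Decidable (j - i = 0))
  | .inr i, .inl j => inferInstanceAs (Decidable (j - i = 0))
  | .inr i, .inr j => inferInstanceAs (Decidable (i ≠ j ∧ (j - i = s ∨ j - i = -s)))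

/-- The rotation of a generalized Petersen graph by `c`. -/
def rotation (s c : ZMod n) : genPetersen n s ≃g genPetersen n s where
  toEquiv := (Equiv.addRight c).sumCongr (Equiv.addRight c)
  map_rel_iff' := by
    rintro (i | i) (j | j) <;> simp [genPetersen]

/-- The reflection of a generalized Petersen graph that fixes the spoke at `0`. -/
def reflection (s : ZMod n) : genPetersen n s ≃g genPetersen n s where
  toEquiv := (Equiv.neg _).sumCongr (Equiv.neg _)
  map_rel_iff' := by
    rintro (i | i) (j | j) <;>
      simp [genPetersen, neg_add_eq_sub, ← neg_sub j i, neg_eq_iff_eq_neg, or_comm, -neg_sub]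

theorem isArcTransitive_of_isEdgeTransitive (h1 : (1 : ZMod n) ≠ 0)
    (h : (genPetersen n s).IsEdgeTransitive) : (genPetersen n s).IsArcTransitive := by
  have outer : (genPetersen n s).Adj (.inl 0) (.inl 1) := adj_inl_inl.2 ⟨h1.symm, by simp⟩
  refine isArcTransitive_of_isEdgeTransitive_of_swap h outer
    (ρ := (reflection s).trans (rotation s 1)) ?_ ?_ <;>
  simp [reflection, rotation]

theorem two_mul_ne_zero_of_isArcTransitive [NeZero n] (hn : 3 ≤ n)
    (harc : (genPetersen n s).IsArcTransitive) : 2 * s ≠ 0 := by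
  intro h
  have hs : -s = s := by linear_combination -h
  have h1 : (1 : ZMod n) ≠ 0 := by
    exact_mod_cast (ZMod.natCast_eq_zero_iff 1 n).not.2 fun hd => by
      have := Nat.le_of_dvd one_pos hd
      omega
  have h2 : (2 : ZMod n) ≠ 0 := by
    exact_mod_cast (ZMod.natCast_eq_zero_iff 2 n).not.2 fun hd => by
      have := Nat.le_of_dvd two_pos hd
      omega
  have h1' : (1 : ZMod n) ≠ -1 := fun h => h2 (by linear_combination h)
  have outer : 3 ≤ (genPetersen n s).degree (.inl 0) := by
    have hsub : {.inl 1, .inl (-1), .inr 0} ⊆ (genPetersen n s).neighborFinset (.inl 0) := by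
      simp [Finset.insert_subset_iff, adj_inl_inl, adj_inl_inr, h1, h1.symm]
    have hcard : ({.inl 1, .inl (-1), .inr 0} : Finset (ZMod n ⊕ ZMod n)).card = 3 := by
      simp [Finset.card_insert_of_notMem, h1']
    exact hcard ▸ Finset.card_le_card hsub
  have inner : (genPetersen n s).degree (.inr 0) ≤ 2 := by
    have hsub : (genPetersen n s).neighborFinset (.inr 0) ⊆ {.inl 0, .inr s} := by
      rintro (j | j) <;> simp +contextual [adj_inr_inl, adj_inr_inr, hs, eq_comm]
    exact (Finset.card_le_card hsub).trans Finset.card_le_two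
  have := degree_eq_of_isArcTransitive harc (adj_inl_inr (s := s).2 (rfl : (0 : ZMod n) = 0))
  omega

/-- The outer edge joining the outer vertices `i` and `i + 1`. -/
def outerEdge (i : ZMod n) : Sym2 (ZMod n ⊕ ZMod n) := s(.inl i, .inl (i + 1))

/-- The spoke at `i`. -/
def spoke (i : ZMod n) : Sym2 (ZMod n ⊕ ZMod n) := s(.inl i, .inr i)

/-- The inner edge joining the inner vertices `i` and `i + s`. -/
def innerEdge (s i : ZMod n) : Sym2 (ZMod n ⊕ ZMod n) := s(.inr i, .inr (i + s))

theorem exists_eq_of_mem_edgeSet {e : Sym2 (ZMod n ⊕ ZMod n)}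
    (he : e ∈ (genPetersen n s).edgeSet) :
    ∃ i, e = outerEdge i ∨ e = spoke i ∨ e = innerEdge s i := by
  induction e with | _ x y =>
  have hxy : (genPetersen n s).Adj x y := he
  rcases x with i | i <;> rcases y with j | j
  · obtain ⟨-, h | h⟩ := adj_inl_inl.1 hxy
    · exact ⟨i, .inl (by rw [outerEdge, ← h, add_sub_cancel])⟩
    · exact ⟨j, .inl (by rw [outerEdge, ← neg_eq_iff_eq_neg.2 h, neg_sub, add_sub_cancel,
        Sym2.eq_swap])⟩
  · exact ⟨i, .inr (.inl (by rw [spoke, adj_inl_inr.1 hxy]))⟩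
  · exact ⟨i, .inr (.inl (by rw [spoke, adj_inr_inl.1 hxy, Sym2.eq_swap]))⟩
  · obtain ⟨-, h | h⟩ := adj_inr_inr.1 hxy
    · exact ⟨i, .inr (.inr (by rw [innerEdge, ← h, add_sub_cancel]))⟩
    · exact ⟨j, .inr (.inr (by rw [innerEdge, ← neg_eq_iff_eq_neg.2 h, neg_sub, add_sub_cancel,
        Sym2.eq_swap]))⟩

theorem map_rotation_outerEdge (c i : ZMod n) :
    Sym2.map (rotation s c) (outerEdge i) = outerEdge (i + c) := by
  simp [outerEdge, rotation, add_right_comm]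

theorem map_rotation_spoke (c i : ZMod n) :
    Sym2.map (rotation s c) (spoke i) = spoke (i + c) := by
  simp [spoke, rotation]

theorem map_rotation_innerEdge (c i : ZMod n) :
    Sym2.map (rotation s c) (innerEdge s i) = innerEdge s (i + c) := by
  simp [innerEdge, rotation, add_right_comm]

theorem isEdgeTransitive_of_map_eq_spoke {φ : genPetersen n s ≃g genPetersen n s}
    (outer : ∃ i j, Sym2.map φ (outerEdge i) = spoke j)
    (inner : ∃ i j, Sym2.map φ (innerEdge s i) = spoke j) :
    (genPetersen n s).IsEdgeTransitive := by
  obtain ⟨i, j, hij⟩ := outer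
  obtain ⟨k, l, hkl⟩ := inner
  refine isEdgeTransitive_of_forall_exists_map (e := spoke 0) fun e he => ?_
  obtain ⟨m, rfl | rfl | rfl⟩ := exists_eq_of_mem_edgeSet he
  · refine ⟨((rotation s (i - m)).trans φ).trans (rotation s (-j)), ?_⟩
    change Sym2.map (rotation s _ ∘ φ ∘ rotation s _) _ = _
    rw [← Sym2.map_map, ← Sym2.map_map, map_rotation_outerEdge, add_sub_cancel, hij,
      map_rotation_spoke, add_neg_cancel]
  · exact ⟨rotation s (-m), by rw [map_rotation_spoke, add_neg_cancel]⟩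
  · refine ⟨((rotation s (k - m)).trans φ).trans (rotation s (-l)), ?_⟩
    change Sym2.map (rotation s _ ∘ φ ∘ rotation s _) _ = _
    rw [← Sym2.map_map, ← Sym2.map_map, map_rotation_innerEdge, add_sub_cancel, hkl,
      map_rotation_spoke, add_neg_cancel]

/-- An involution of the vertices that preserves adjacency and takes some outer edge and some inner
edge to spokes. It is phrased edge by edge so that it can be decided. -/
structure IsMixingInvolution (s : ZMod n) (f : ZMod n ⊕ ZMod n → ZMod n ⊕ ZMod n) : Prop where
  involutive : ∀ x, f (f x) = x
  map_outerEdge : ∀ i, Sym2.map f (outerEdge i) ∈ (genPetersen n s).edgeSet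
  map_spoke : ∀ i, Sym2.map f (spoke i) ∈ (genPetersen n s).edgeSet
  map_innerEdge : ∀ i, Sym2.map f (innerEdge s i) ∈ (genPetersen n s).edgeSet
  outerEdge_to_spoke : ∃ i j, Sym2.map f (outerEdge i) = spoke j
  innerEdge_to_spoke : ∃ i j, Sym2.map f (innerEdge s i) = spoke j

instance decidableIsMixingInvolution [NeZero n] (s : ZMod n)
    (f : ZMod n ⊕ ZMod n → ZMod n ⊕ ZMod n) : Decidable (IsMixingInvolution s f) :=
  decidable_of_iff
    ((∀ x, f (f x) = x) ∧
      (∀ i, Sym2.map f (outerEdge i) ∈ (genPetersen n s).edgeSet) ∧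
      (∀ i, Sym2.map f (spoke i) ∈ (genPetersen n s).edgeSet) ∧
      (∀ i, Sym2.map f (innerEdge s i) ∈ (genPetersen n s).edgeSet) ∧
      (∃ i j, Sym2.map f (outerEdge i) = spoke j) ∧
      ∃ i j, Sym2.map f (innerEdge s i) = spoke j)
    ⟨fun ⟨h, ho, hs, hi, eo, ei⟩ => ⟨h, ho, hs, hi, eo, ei⟩,
      fun ⟨h, ho, hs, hi, eo, ei⟩ => ⟨h, ho, hs, hi, eo, ei⟩⟩

theorem IsMixingInvolution.isEdgeTransitive {f : ZMod n ⊕ ZMod n → ZMod n ⊕ ZMod n}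
    (hf : IsMixingInvolution s f) : (genPetersen n s).IsEdgeTransitive := by
  have map_adj {x y : ZMod n ⊕ ZMod n} (hxy : (genPetersen n s).Adj x y) :
      (genPetersen n s).Adj (f x) (f y) := by
    change Sym2.map f s(x, y) ∈ (genPetersen n s).edgeSet
    obtain ⟨i, hi | hi | hi⟩ := exists_eq_of_mem_edgeSet (e := s(x, y)) hxy <;> rw [hi]
    exacts [hf.map_outerEdge i, hf.map_spoke i, hf.map_innerEdge i]
  let φ : genPetersen n s ≃g genPetersen n s :=
    { toEquiv := Function.Involutive.toPerm f hf.involutive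
      map_rel_iff' := fun {x y} =>
        ⟨fun h => by
          have := map_adj h
          change (genPetersen n s).Adj (f (f x)) (f (f y)) at this
          rwa [hf.involutive, hf.involutive] at this, map_adj⟩ }
  exact isEdgeTransitive_of_map_eq_spoke (φ := φ) hf.outerEdge_to_spoke hf.innerEdge_to_spoke

/-- An automorphism of `GP(n, 5)` for `n = 4, 8, 12, 24`. As `5` is `1` modulo `4` and `-3` modulo
`8`, the graphs `GP(4, 1)`, `GP(8, 3)` and `GP(12, 5)` are quotients of `GP(24, 5)` by rotations, so
that one formula serves all four. Conjugation by it inverts the rotation by `4`. -/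
def swapFour (n : ℕ) : ZMod n ⊕ ZMod n → ZMod n ⊕ ZMod n
  | .inl i => match i.val % 4 with
    | 0 => .inl (-i)
    | 1 => .inr (1 - i)
    | 2 => .inr (-3 - i)
    | _ => .inl (-2 - i)
  | .inr i => match i.val % 4 with
    | 0 => .inl (1 - i)
    | 1 => .inr (6 - i)
    | 2 => .inr (-8 - i)
    | _ => .inl (-3 - i)

/-- An automorphism of `GP(n, 2)` for `n = 5, 10` that commutes with the rotation by `5`. One
formula serves both because `GP(5, 2)` is the quotient of `GP(10, 2)` by that rotation. -/
def swapFiveTwo (n : ℕ) : ZMod n ⊕ ZMod n → ZMod n ⊕ ZMod n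
  | .inl i => match i.val % 5 with
    | 2 => .inr (i - 1)
    | 3 => .inr i
    | 4 => .inr (i + 1)
    | _ => .inl i
  | .inr i => match i.val % 5 with
    | 0 => .inl (i - 1)
    | 1 => .inl (i + 1)
    | 2 => .inr (i - 3)
    | 3 => .inl i
    | _ => .inr (i + 3)

/-- An automorphism of `GP(10, 3)` that commutes with the rotation by `5`. -/
def swapFiveThree : ZMod 10 ⊕ ZMod 10 → ZMod 10 ⊕ ZMod 10
  | .inl i => match i.val % 5 with
    | 3 => .inr (i - 1)
    | 4 => .inr (i + 1)
    | _ => .inl i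
  | .inr i => match i.val % 5 with
    | 0 => .inl (i - 1)
    | 1 => .inr i
    | 2 => .inl (i + 1)
    | 3 => .inr (i - 4)
    | _ => .inr (i + 4)

theorem isEdgeTransitive_of_mem_gpPairs {n m : ℕ} (h : (n, m) ∈ gpPairs) :
    (genPetersen n m).IsEdgeTransitive := by
  simp only [gpPairs, Finset.mem_insert, Finset.mem_singleton, Prod.mk.injEq] at h
  obtain ⟨rfl, rfl⟩ | ⟨rfl, rfl⟩ | ⟨rfl, rfl⟩ | ⟨rfl, rfl⟩ | ⟨rfl, rfl⟩ | ⟨rfl, rfl⟩ |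
    ⟨rfl, rfl⟩ := h
  · exact IsMixingInvolution.isEdgeTransitive (f := swapFour 4) (by decide +kernel)
  · exact IsMixingInvolution.isEdgeTransitive (f := swapFiveTwo 5) (by decide +kernel)
  · exact IsMixingInvolution.isEdgeTransitive (f := swapFour 8) (by decide +kernel)
  · exact IsMixingInvolution.isEdgeTransitive (f := swapFiveTwo 10) (by decide +kernel)
  · exact IsMixingInvolution.isEdgeTransitive (f := swapFiveThree) (by decide +kernel)
  · exact IsMixingInvolution.isEdgeTransitive (f := swapFour 12) (by decide +kernel)
  · exact IsMixingInvolution.isEdgeTransitive (f := swapFour 24) (by decide +kernel)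

end Automorphisms

section Cover

/-- The vertices of the common cover of the generalized Petersen graphs: outer and inner vertices
indexed by `ℤ × ℤ`. -/
abbrev Cover := (ℤ × ℤ) ⊕ (ℤ × ℤ)

/-- The neighbors in the cover, where outer edges change the first coordinate and inner edges the
second one. -/
def coverNbrs : Cover → List Cover
  | .inl p => [.inl (p + (1, 0)), .inl (p - (1, 0)), .inr p]
  | .inr p => [.inr (p + (0, 1)), .inr (p - (0, 1)), .inl p]

theorem mem_coverNbrs_inl {p : ℤ × ℤ} {z : Cover} : z ∈ coverNbrs (.inl p) ↔
    z = .inl (p + (1, 0)) ∨ z = .inl (p - (1, 0)) ∨ z = .inr p := by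
  simp [coverNbrs]

theorem mem_coverNbrs_inr {p : ℤ × ℤ} {z : Cover} : z ∈ coverNbrs (.inr p) ↔
    z = .inr (p + (0, 1)) ∨ z = .inr (p - (0, 1)) ∨ z = .inl p := by
  simp [coverNbrs]

/-- The coordinates of a vertex of the cover. -/
def coverPos : Cover → ℤ × ℤ := Sum.elim id id

/-- The deck transformation of the cover that adds `p` to the coordinates. -/
def coverShift (p : ℤ × ℤ) : Cover → Cover := Sum.map (· + p) (· + p)

/-- The displacements between the ends of the non-backtracking walks with `k + 1` steps in the cover
whose first step is `(x, y)` and whose last step is a translate of it. -/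
def windings (k : ℕ) (x y : Cover) : Multiset (ℤ × ℤ) :=
  ↑(((nbWalkEnds coverNbrs k x y).filter fun e =>
    e = (coverShift (coverPos e.1) x, coverShift (coverPos e.1) y)).map fun e => coverPos e.1)

variable {n : ℕ}

/-- The index of the vertices of `GP(n, s)` over the vertices of the cover with coordinates `p`. -/
def residue (s : ZMod n) (p : ℤ × ℤ) : ZMod n := p.1 + p.2 * s

/-- The projection of the cover to `GP(n, s)`. -/
def coverProj (s : ZMod n) : Cover → ZMod n ⊕ ZMod n := Sum.map (residue s) (residue s)

variable {s : ZMod n}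

theorem residue_add (p q : ℤ × ℤ) : residue s (p + q) = residue s p + residue s q := by
  simp only [residue, Prod.fst_add, Prod.snd_add, Int.cast_add]
  ring

theorem residue_sub (p q : ℤ × ℤ) : residue s (p - q) = residue s p - residue s q := by
  simp only [residue, Prod.fst_sub, Prod.snd_sub, Int.cast_sub]
  ring

theorem residue_neg (p : ℤ × ℤ) : residue s (-p) = -residue s p := by
  simp only [residue, Prod.fst_neg, Prod.snd_neg, Int.cast_neg]
  ring

theorem residue_one_zero : residue s (1, 0) = 1 := by simp [residue]

theorem residue_zero_one : residue s (0, 1) = s := by simp [residue]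

theorem coverProj_coverShift {p : ℤ × ℤ} (hp : residue s p = 0) (x : Cover) :
    coverProj s (coverShift p x) = coverProj s x := by
  rcases x with x | x <;> simp [coverProj, coverShift, residue_add, hp]

theorem coverShift_mem_coverNbrs (p : ℤ × ℤ) {x y : Cover} (hxy : y ∈ coverNbrs x) :
    coverShift p y ∈ coverNbrs (coverShift p x) := by
  rcases x with q | q
  · obtain rfl | rfl | rfl := mem_coverNbrs_inl.1 hxy <;>
      simp [coverShift, mem_coverNbrs_inl, add_right_comm, sub_add_eq_add_sub]
  · obtain rfl | rfl | rfl := mem_coverNbrs_inr.1 hxy <;>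
      simp [coverShift, mem_coverNbrs_inr, add_right_comm, sub_add_eq_add_sub]

theorem isGraphCover (h : 2 * s ≠ 0) :
    IsGraphCover (genPetersen n s) coverNbrs (coverProj s) where
  mem_symm {w z} hz := by
    rcases w with p | p
    · obtain rfl | rfl | rfl := mem_coverNbrs_inl.1 hz <;>
        simp [mem_coverNbrs_inl, mem_coverNbrs_inr]
    · obtain rfl | rfl | rfl := mem_coverNbrs_inr.1 hz <;>
        simp [mem_coverNbrs_inl, mem_coverNbrs_inr]
  nodup_map w := by
    have distinct {r t : ZMod n} (ht : 2 * t ≠ 0) : r + t ≠ r - t :=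
      fun h => ht (by linear_combination h)
    have h2 : 2 * (1 : ZMod n) ≠ 0 := by simpa using left_ne_zero_of_mul h
    rcases w with p | p <;>
      simp [coverNbrs, coverProj, residue_add, residue_sub, residue_one_zero, residue_zero_one,
        distinct h, distinct h2]
  mem_map_iff w v := by
    have rim {t : ZMod n} (ht : t ≠ 0) (i j : ZMod n) :
        j = i + t ∨ j = i - t ↔ i ≠ j ∧ (j - i = t ∨ j - i = -t) := by
      rw [sub_eq_iff_eq_add', sub_eq_iff_eq_add', ← sub_eq_add_neg]
      refine (and_iff_right_of_imp ?_).symm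
      rintro (rfl | rfl) <;> simp [ht, left_eq_add, eq_sub_iff_add_eq]
    have h1 : (1 : ZMod n) ≠ 0 := fun h1 => h (by linear_combination 2 * s * h1)
    have hs : s ≠ 0 := right_ne_zero_of_mul h
    rcases w with p | p <;> rcases v with j | j <;>
      simp [coverNbrs, coverProj, residue_add, residue_sub, residue_one_zero, residue_zero_one,
        adj_inl_inl, adj_inr_inr, adj_inl_inr, adj_inr_inl, rim h1, rim hs, eq_comm]

theorem eq_coverShift_of_coverProj_eq {x z : Cover} (hx : coverPos x = 0)
    (h : coverProj s z = coverProj s x) :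
    residue s (coverPos z) = 0 ∧ z = coverShift (coverPos z) x := by
  rcases x with p | p <;> rcases z with q | q <;>
    simp_all [coverPos, coverProj, coverShift, residue]

theorem nbWalkCount_coverProj [NeZero n] (h : 2 * s ≠ 0) (k : ℕ) {x y : Cover}
    (hx : coverPos x = 0) (hxy : y ∈ coverNbrs x) :
    nbWalkCount (genPetersen n s) k (coverProj s x) (coverProj s y) (coverProj s x)
      (coverProj s y) = (windings k x y).countP fun p => residue s p = 0 := by
  have hG := isGraphCover h
  rw [hG.nbWalkCount_eq k hxy, windings, Multiset.coe_countP, List.countP_map, List.countP_filter]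
  refine List.countP_congr fun e he => ?_
  simp only [decide_eq_true_eq, Function.comp_apply, Bool.and_eq_true]
  constructor
  · rintro ⟨h₁, h₂⟩
    obtain ⟨hp, hx₁⟩ := eq_coverShift_of_coverProj_eq hx h₁
    have mem₁ : e.2 ∈ coverNbrs e.1 := mem_of_mem_nbWalkEnds hxy he
    have mem₂ := coverShift_mem_coverNbrs (coverPos e.1) hxy
    rw [← hx₁] at mem₂
    exact ⟨hp, Prod.ext hx₁
      (hG.injOn e.1 mem₁ mem₂ (h₂.trans (coverProj_coverShift hp y).symm))⟩
  · rintro ⟨hp, he⟩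
    rw [he]
    exact ⟨coverProj_coverShift hp x, coverProj_coverShift hp y⟩

/-- The number of displacements in `M`, counted with multiplicity, that are relations between `1`
and `s` in `ZMod n`. -/
def relCount (s : ZMod n) (M : Multiset (ℤ × ℤ)) : ℕ := M.countP fun p => residue s p = 0

theorem relCount_windings_eq_spoke (h : 2 * s ≠ 0) [NeZero n]
    (harc : (genPetersen n s).IsArcTransitive) (k : ℕ) {x y : Cover} (hx : coverPos x = 0)
    (hxy : y ∈ coverNbrs x) :
    relCount s (windings k x y) = relCount s (windings k (.inl 0) (.inr 0)) := by
  have hspoke : (.inr 0 : Cover) ∈ coverNbrs (.inl 0) := by simp [coverNbrs]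
  have hG := isGraphCover h
  rw [relCount, relCount, ← nbWalkCount_coverProj h k hx hxy,
    ← nbWalkCount_coverProj h k rfl hspoke]
  exact nbWalkCount_eq_of_isArcTransitive harc k (hG.adj hxy) (hG.adj hspoke)

theorem relCount_add (M N : Multiset (ℤ × ℤ)) :
    relCount s (M + N) = relCount s M + relCount s N :=
  Multiset.countP_add _ _ _

theorem relCount_nsmul (k : ℕ) (M : Multiset (ℤ × ℤ)) :
    relCount s (k • M) = k * relCount s M :=
  Multiset.countP_nsmul _ _ _

theorem relCount_map_neg (M : Multiset (ℤ × ℤ)) :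
    relCount s (M.map Neg.neg) = relCount s M := by
  rw [relCount, relCount, Multiset.countP_map, Multiset.countP_eq_card_filter]
  simp only [residue_neg, neg_eq_zero]

theorem relCount_singleton (p : ℤ × ℤ) :
    relCount s {p} = if residue s p = 0 then 1 else 0 := by
  simp [relCount, Multiset.countP_eq_card_filter, Multiset.filter_singleton, apply_ite]

/-- The displacements `(a, b)` and `(a, -b)`. One of them is a relation if and only if
`a = ±b * s`. -/
def pm (a b : ℤ) : Multiset (ℤ × ℤ) := {(a, b)} + {(a, -b)}

theorem relCount_map_swap_pm (a b : ℤ) :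
    relCount s ((pm a b).map Prod.swap) = relCount s (pm b a) := by
  rw [pm, pm, Multiset.map_add, relCount_add, relCount_add, Multiset.map_singleton,
    Multiset.map_singleton, Prod.swap_prod_mk, Prod.swap_prod_mk, ← relCount_map_neg {(-b, a)},
    Multiset.map_singleton, Prod.neg_mk, neg_neg]

theorem relCount_pm (a b : ℤ) : relCount s (pm a b) =
    (if (a : ZMod n) = -(b * s) then 1 else 0) + if (a : ZMod n) = b * s then 1 else 0 := by
  simp only [pm, relCount_add, relCount_singleton, residue, add_eq_zero_iff_eq_neg, Int.cast_neg,
    neg_mul, neg_neg]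

theorem relCount_pm_ne_zero {a b : ℤ} :
    relCount s (pm a b) ≠ 0 ↔ (a : ZMod n) = b * s ∨ (a : ZMod n) = -(b * s) := by
  simp only [relCount_pm, ne_eq, Nat.add_eq_zero_iff, ite_eq_right_iff, one_ne_zero, imp_false]
  tauto

theorem add_mul_eq_zero_iff_of_relCount_eq {a b c d : ℤ}
    (h : relCount s {(a, b)} = relCount s (pm c d)) :
    (a + b * s = 0 ↔ (c : ZMod n) = d * s ∨ (c : ZMod n) = -(d * s)) := by
  rw [← relCount_pm_ne_zero, ← h, relCount_singleton, residue]
  simp only [ne_eq, ite_eq_right_iff, one_ne_zero, imp_false, not_not]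

theorem relCount_pm_le_one {a b : ℤ} (ha : 2 * (a : ZMod n) ≠ 0) : relCount s (pm a b) ≤ 1 := by
  have not_both : ¬ ((a : ZMod n) = -(b * s) ∧ (a : ZMod n) = b * s) :=
    fun ⟨h₁, h₂⟩ => ha (by linear_combination h₁ + h₂)
  rw [relCount_pm]
  split_ifs with h₁ h₂
  · exact absurd ⟨h₁, h₂⟩ not_both
  all_goals norm_num

variable [NeZero n]

theorem relCount_balance (h : 2 * s ≠ 0) (harc : (genPetersen n s).IsArcTransitive) (k : ℕ)
    {M N : Multiset (ℤ × ℤ)} (outer : windings k (.inl 0) (.inl (1, 0)) = M)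
    (inner : windings k (.inr 0) (.inr (0, 1)) = M.map Prod.swap)
    (spoke : windings k (.inl 0) (.inr 0) = N + N.map Neg.neg) :
    relCount s M = 2 * relCount s N ∧ relCount s (M.map Prod.swap) = 2 * relCount s N := by
  have hN : relCount s (windings k (.inl 0) (.inr 0)) = 2 * relCount s N := by
    rw [spoke, relCount_add, relCount_map_neg, two_mul]
  rw [← hN, ← inner, ← outer]
  exact ⟨relCount_windings_eq_spoke h harc k rfl (by simp [coverNbrs]),
    relCount_windings_eq_spoke h harc k rfl (by simp [coverNbrs])⟩

theorem balance_four (h : 2 * s ≠ 0) (harc : (genPetersen n s).IsArcTransitive) :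
    relCount s {(4, 0)} = relCount s (pm 1 1) ∧ relCount s {(0, 4)} = relCount s (pm 1 1) := by
  have := relCount_balance h harc 4 (M := {(4, 0)} + pm 1 1) (N := pm 1 1) (by decide +kernel)
    (by decide +kernel) (by decide +kernel)
  simp only [relCount_add, Multiset.map_add, Multiset.map_singleton, Prod.swap_prod_mk,
    relCount_map_swap_pm] at this
  omega

theorem balance_five (h : 2 * s ≠ 0) (harc : (genPetersen n s).IsArcTransitive) :
    relCount s {(5, 0)} = relCount s (pm 1 2) ∧ relCount s {(0, 5)} = relCount s (pm 2 1) := by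
  have := relCount_balance h harc 5 (M := {(5, 0)} + pm 1 2 + 2 • pm 2 1) (N := pm 1 2 + pm 2 1)
    (by decide +kernel) (by decide +kernel) (by decide +kernel)
  simp only [relCount_add, relCount_nsmul, Multiset.map_add, Multiset.map_nsmul,
    Multiset.map_singleton, Prod.swap_prod_mk, relCount_map_swap_pm] at this
  omega

theorem balance_six (h : 2 * s ≠ 0) (harc : (genPetersen n s).IsArcTransitive) :
    relCount s {(6, 0)} + relCount s (pm 3 1) = relCount s (pm 1 3) ∧
      relCount s {(0, 6)} + relCount s (pm 1 3) = relCount s (pm 3 1) := by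
  have := relCount_balance h harc 6 (M := {(6, 0)} + pm 1 3 + 2 • pm 2 2 + 3 • pm 3 1)
    (N := pm 1 3 + pm 2 2 + pm 3 1)
    (by decide +kernel) (by decide +kernel) (by decide +kernel)
  simp only [relCount_add, relCount_nsmul, Multiset.map_add, Multiset.map_nsmul,
    Multiset.map_singleton, Prod.swap_prod_mk, relCount_map_swap_pm] at this
  omega

theorem balance_eight (h : 2 * s ≠ 0) (harc : (genPetersen n s).IsArcTransitive) :
    relCount s {(8, 0)} + relCount s (pm 3 3) + 2 * relCount s (pm 4 2) + 3 * relCount s (pm 5 1) =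
        relCount s (pm 1 5) + 2 + relCount s (pm 2 2) ∧
      relCount s {(0, 8)} + relCount s (pm 3 3) + 2 * relCount s (pm 2 4) +
        3 * relCount s (pm 1 5) = relCount s (pm 5 1) + 2 + relCount s (pm 2 2) := by
  have h00 : relCount s (pm 0 0) = 2 := by simp [relCount_pm]
  have h20 : relCount s (pm 2 0) = 0 := by simp [relCount_pm, left_ne_zero_of_mul h]
  have h02 : relCount s (pm 0 2) = 0 := by
    simp [relCount_pm, eq_comm (a := (0 : ZMod n)), h]
  have := relCount_balance h harc 8
    (M := {(8, 0)} + pm 1 5 + 2 • pm 2 4 + 3 • pm 3 3 + 4 • pm 4 2 + 5 • pm 5 1 +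
      (pm 0 0 + pm 2 0 + pm 0 2 + pm 2 2))
    (N := pm 1 5 + pm 2 4 + pm 3 3 + pm 4 2 + pm 5 1 + (pm 0 0 + pm 2 0 + pm 0 2 + pm 2 2))
    (by decide +kernel) (by decide +kernel) (by decide +kernel)
  simp only [relCount_add, relCount_nsmul, Multiset.map_add, Multiset.map_nsmul,
    Multiset.map_singleton, Prod.swap_prod_mk, relCount_map_swap_pm, h00, h20, h02] at this
  omega

end Cover

section ShortRelations

variable {n : ℕ} {s : ZMod n}

/-- What comparing the closed walks of length at most `6` through the arcs of an arc-transitive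
`GP(n, s)` says about the relations between `1` and `s`. -/
structure ShortRelations (s : ZMod n) : Prop where
  four_eq_zero_iff : (4 : ZMod n) = 0 ↔ 1 = s ∨ 1 = -s
  four_mul_eq_zero_iff : 4 * s = 0 ↔ 1 = s ∨ 1 = -s
  five_mul_eq_zero_iff : 5 * s = 0 ↔ 2 = s ∨ 2 = -s
  six_ne_zero : (6 : ZMod n) ≠ 0
  six_mul_ne_zero : 6 * s ≠ 0

theorem ShortRelations.mem_gpPairs (hR : ShortRelations s)
    (hn : (8 : ZMod n) = 0 ∨ (10 : ZMod n) = 0 ∨ (12 : ZMod n) = 0) :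
    (n, s.val) ∈ gpPairs ∨ (n, (-s).val) ∈ gpPairs := by
  obtain ⟨four, four_mul, five_mul, six, six_mul⟩ := hR
  have dvd (m : ℕ) : (m : ZMod n) = 0 ↔ n ∣ m := ZMod.natCast_eq_zero_iff m n
  have not_dvd : ¬ n ∣ 6 := fun hd => six (by exact_mod_cast (dvd 6).2 hd)
  have dvd_or : n ∣ 8 ∨ n ∣ 10 ∨ n ∣ 12 := by
    rw [← dvd, ← dvd, ← dvd]
    exact_mod_cast hn
  have hn : n ≤ 12 := by
    obtain h | h | h := dvd_or <;> exact (Nat.le_of_dvd (by norm_num) h).trans (by norm_num)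
  have cases : n = 4 ∨ n = 5 ∨ n = 8 ∨ n = 10 ∨ n = 12 := by
    interval_cases n <;> omega
  clear dvd not_dvd dvd_or hn
  obtain rfl | rfl | rfl | rfl | rfl := cases <;> revert s <;> decide

theorem eq_thirteen_or_eq_twentyFour_or_eq_twentySix
    (hn8 : (8 : ZMod n) ≠ 0) (hn12 : (12 : ZMod n) ≠ 0)
    (h5 : 5 = s ∨ 5 = -s) (h51 : 1 = 5 * s ∨ 1 = -(5 * s)) : n = 13 ∨ n = 24 ∨ n = 26 := by
  have dvd (m : ℕ) : (m : ZMod n) = 0 ↔ n ∣ m := ZMod.natCast_eq_zero_iff m n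
  have hn : ((24 : ℕ) : ZMod n) = 0 ∨ ((26 : ℕ) : ZMod n) = 0 := by
    push_cast
    grind
  have not_dvd_eight : ¬ n ∣ 8 := fun hd => hn8 (by exact_mod_cast (dvd 8).2 hd)
  have not_dvd_twelve : ¬ n ∣ 12 := fun hd => hn12 (by exact_mod_cast (dvd 12).2 hd)
  rw [dvd, dvd] at hn
  have hn26 : n ≤ 26 := by
    obtain h | h := hn <;> exact (Nat.le_of_dvd (by norm_num) h).trans (by norm_num)
  interval_cases n <;> omega

theorem relCount_windings_ten_ne_of_thirteen : ∀ s : ZMod 13, 5 = s ∨ 5 = -s →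
    relCount s (windings 10 (.inl 0) (.inl (1, 0))) ≠
      relCount s (windings 10 (.inl 0) (.inr 0)) := by
  decide +kernel

theorem relCount_windings_ten_ne_of_twentySix : ∀ s : ZMod 26, 5 = s ∨ 5 = -s →
    relCount s (windings 10 (.inl 0) (.inl (1, 0))) ≠
      relCount s (windings 10 (.inl 0) (.inr 0)) := by
  decide +kernel

variable [NeZero n]

theorem shortRelations_of_isArcTransitive (h : 2 * s ≠ 0)
    (harc : (genPetersen n s).IsArcTransitive) : ShortRelations s := by
  have b4 := balance_four h harc
  have b5 := balance_five h harc
  have b6 := balance_six h harc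
  have r60 : relCount s {(6, 0)} = 0 := by omega
  have r06 : relCount s {(0, 6)} = 0 := by omega
  exact
    { four_eq_zero_iff := by simpa using add_mul_eq_zero_iff_of_relCount_eq b4.1
      four_mul_eq_zero_iff := by simpa using add_mul_eq_zero_iff_of_relCount_eq b4.2
      five_mul_eq_zero_iff := by simpa using add_mul_eq_zero_iff_of_relCount_eq b5.2
      six_ne_zero := by simpa [relCount_singleton, residue] using r60
      six_mul_ne_zero := by simpa [relCount_singleton, residue] using r06 }

theorem relCount_pm_two_two_eq_zero (h : 2 * s ≠ 0) (harc : (genPetersen n s).IsArcTransitive)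
    (hn8 : (8 : ZMod n) ≠ 0) (hn12 : (12 : ZMod n) ≠ 0) : relCount s (pm 2 2) = 0 := by
  have hR := shortRelations_of_isArcTransitive h harc
  have hs : ¬ (1 = s ∨ 1 = -s) :=
    fun hs => hn8 (by linear_combination 2 * hR.four_eq_zero_iff.2 hs)
  by_contra g22
  have g22_le : relCount s (pm 2 2) ≤ 1 :=
    relCount_pm_le_one fun h' => hn8 (by push_cast at h'; linear_combination 2 * h')
  have eq_two := relCount_pm_ne_zero.1 g22
  push_cast at eq_two
  have r80 : relCount s {(8, 0)} = 0 := by simpa [relCount_singleton, residue] using hn8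
  have r08 : relCount s {(0, 8)} = 0 := by
    simp only [relCount_singleton, residue]
    push_cast
    grind
  have g33 : relCount s (pm 3 3) = 0 := by
    rw [← not_ne_iff, relCount_pm_ne_zero]
    push_cast
    rintro (h₃ | h₃) <;> obtain h₂ | h₂ := eq_two
    · exact hs (.inl (by linear_combination h₃ - h₂))
    · exact hn12 (by linear_combination 2 * h₃ + 3 * h₂)
    · exact hn12 (by linear_combination 2 * h₃ + 3 * h₂)
    · exact hs (.inr (by linear_combination h₃ - h₂))
  have g42 : relCount s (pm 4 2) = 0 := by
    rw [← not_ne_iff, relCount_pm_ne_zero]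
    push_cast
    grind [hR.six_ne_zero]
  have g24 : relCount s (pm 2 4) = 0 := by
    rw [← not_ne_iff, relCount_pm_ne_zero]
    push_cast
    grind [hR.six_ne_zero]
  -- Writing `x` and `y` for the counts of `pm 5 1` and `pm 1 5`, this says `3 * x = y + 3` and
  -- `3 * y = x + 3`, so that `2 * x = 3`.
  have b8 := balance_eight h harc
  omega

theorem eq_five_or_eq_neg_five (h : 2 * s ≠ 0) (harc : (genPetersen n s).IsArcTransitive)
    (hn8 : (8 : ZMod n) ≠ 0) (hn10 : (10 : ZMod n) ≠ 0) (hn12 : (12 : ZMod n) ≠ 0) :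
    (5 = s ∨ 5 = -s) ∧ (1 = 5 * s ∨ 1 = -(5 * s)) := by
  have h6 := (shortRelations_of_isArcTransitive h harc).six_ne_zero
  have g22 := relCount_pm_two_two_eq_zero h harc hn8 hn12
  have r80 : relCount s {(8, 0)} = 0 := by simpa [relCount_singleton, residue] using hn8
  have r08 : relCount s {(0, 8)} ≤ 1 := Multiset.countP_le_card _ _
  have g33 : relCount s (pm 3 3) ≤ 1 :=
    relCount_pm_le_one fun h' => h6 (by push_cast at h'; linear_combination h')
  have g42 : relCount s (pm 4 2) ≤ 1 :=
    relCount_pm_le_one fun h' => hn8 (by push_cast at h'; linear_combination h')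
  have g15 : relCount s (pm 1 5) ≤ 1 :=
    relCount_pm_le_one fun h' => hn8 (by push_cast at h'; linear_combination 4 * h')
  have not_both : ¬ (relCount s (pm 4 2) ≠ 0 ∧ relCount s (pm 2 4) ≠ 0) := by
    simp only [relCount_pm_ne_zero]
    push_cast
    grind
  have b8 := balance_eight h harc
  have g51 : relCount s (pm 5 1) ≠ 0 ∧ relCount s (pm 1 5) ≠ 0 := by omega
  simpa [relCount_pm_ne_zero] using g51

theorem mem_gpPairs_of_eq_five (h : 2 * s ≠ 0) (harc : (genPetersen n s).IsArcTransitive)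
    (hn8 : (8 : ZMod n) ≠ 0) (hn12 : (12 : ZMod n) ≠ 0)
    (h5 : 5 = s ∨ 5 = -s) (h51 : 1 = 5 * s ∨ 1 = -(5 * s)) :
    (n, s.val) ∈ gpPairs ∨ (n, (-s).val) ∈ gpPairs := by
  have b10 := relCount_windings_eq_spoke h harc 10 (x := .inl 0) (y := .inl (1, 0)) rfl
    (by simp [coverNbrs])
  have twentyFour : ∀ s : ZMod 24, 5 = s ∨ 5 = -s →
      (24, s.val) ∈ gpPairs ∨ (24, (-s).val) ∈ gpPairs := by
    decide
  obtain rfl | rfl | rfl := eq_thirteen_or_eq_twentyFour_or_eq_twentySix hn8 hn12 h5 h51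
  · exact absurd b10 (relCount_windings_ten_ne_of_thirteen s h5)
  · exact twentyFour s h5
  · exact absurd b10 (relCount_windings_ten_ne_of_twentySix s h5)

theorem mem_gpPairs_of_isArcTransitive (h : 2 * s ≠ 0)
    (harc : (genPetersen n s).IsArcTransitive) :
    (n, s.val) ∈ gpPairs ∨ (n, (-s).val) ∈ gpPairs := by
  by_cases hn : (8 : ZMod n) = 0 ∨ (10 : ZMod n) = 0 ∨ (12 : ZMod n) = 0
  · exact (shortRelations_of_isArcTransitive h harc).mem_gpPairs hn
  · push Not at hn
    obtain ⟨hn8, hn10, hn12⟩ := hn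
    obtain ⟨h5, h51⟩ := eq_five_or_eq_neg_five h harc hn8 hn10 hn12
    exact mem_gpPairs_of_eq_five h harc hn8 hn12 h5 h51

end ShortRelations

end genPetersen

/-- Since `GP(n,s)` and `GP(n,-s)` are the same graph, the parameter `s : ZMod n` is compared with
the list up to sign, through the representatives of `s` and `-s` in `{0, …, n-1}`. -/
theorem theoremt (n : ℕ) (hn : 3 ≤ n) (s : ZMod n) (hs : s ≠ 0) :
    ((genPetersen n s).IsEdgeTransitive ↔ (n, s.val) ∈ gpPairs ∨ (n, (-s).val) ∈ gpPairs) ∧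
      ((genPetersen n s).IsEdgeTransitive → (genPetersen n s).IsArcTransitive) := by
  have : NeZero n := ⟨by omega⟩
  have : Fact (1 < n) := ⟨by omega⟩
  have harc : (genPetersen n s).IsEdgeTransitive → (genPetersen n s).IsArcTransitive :=
    genPetersen.isArcTransitive_of_isEdgeTransitive one_ne_zero
  refine ⟨⟨fun h => ?_, ?_⟩, harc⟩
  · exact genPetersen.mem_gpPairs_of_isArcTransitive
      (genPetersen.two_mul_ne_zero_of_isArcTransitive hn (harc h)) (harc h)
  · rintro (h | h)
    · simpa using genPetersen.isEdgeTransitive_of_mem_gpPairs h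
    · simpa [genPetersen.neg_right] using genPetersen.isEdgeTransitive_of_mem_gpPairs h
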